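/- Let $\mathbf M$ be a finite algebra over an algebraic language (algebras are non-empty), and let $\mathcal A=\mathrm{ISP}(\mathbf M)$ be the class of algebras isomorphic to subalgebras of powers of $\mathbf M$ (empty powers allowed). Let $\widetilde{\mathbf M}=(M;G,H,R,\mathcal T)$ be an alter ego of $\mathbf M$: $\mathcal T$ is the discrete topology, the elements of $G$ are homomorphisms $\mathbf M^n\to\mathbf M$ ($n\ge 0$), the elements of $H$ are partial operations that are homomorphisms from subalgebras of $\mathbf M^n$ to $\mathbf M$ ($n\ge1$), and the elements of $R$ are subalgebras of $\mathbf M^n$ ($n\ge1$). Let $\mathcal X$ be the category of isomorphic copies of closed substructures of non-empty powers of $\widetilde{\mathbf M}$ (including the empty structure if $G$ has no nullary operation), with continuous structure-preserving maps as morphisms. For $\mathbf A\in\mathcal A$ let $D(\mathbf A)$ be the set of homomorphisms $\mathbf A\to\mathbf M$, as a closed substructure of $\widetilde{\mathbf M}^{A}$, and for a homomorphism $f$ let $D(f)$ be $x\mapsto x\circ f$; for $\mathbf X\in\mathcal X$ let $E(\mathbf X)$ be the set of morphisms $\mathbf X\to\widetilde{\mathbf M}$, as a subalgebra of $\mathbf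 M^{X}$. Assume that $\widetilde{\mathbf M}$ yields a strong duality on $\mathcal A$: all evaluation maps $\mathbf C\to ED(\mathbf C)$ ($\mathbf C\in\mathcal A$) and $\mathbf X\to DE(\mathbf X)$ ($\mathbf X\in\mathcal X$) are isomorphisms, and $\widetilde{\mathbf M}$ is injective in $\mathcal X$ with respect to embeddings. For a class $\mathcal K$ of algebras let $\mathrm{Con}_{\mathcal K}(\mathbf A)$ be the set of congruences $\theta$ of $\mathbf A$ with $\mathbf A/\theta\in\mathcal K$, ordered by inclusion. Substructures (possibly empty) are subsets closed under $G$, and under the elements of $H$ where these are defined; $\langle S\rangle$ is the substructure generated by $S$. A substructure $\mathbf Z$ of $\mathbf X$ is a $\mathbf Y$-substructure if $\mathbf Z=\langle \operatorname{im}\varphi_1\cup\dots\cup\operatorname{im}\varphi_m\rangle$ for some $m\ge0$ and morphisms $\varphi_1,\dots,\varphi_m\colon\mathbf Y\to\mathbf X$. **Proposition.** Let $\mathbf A,\mathbf B\in\mathcal A$ be finite and let $\mathcal Q=\mathrm{ISP}(\mathbf B)$. The map $\theta\mapsto \mathbf Z_\theta=\operatorname{im}D(\mathbf A\to\mathbf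 A/\theta)$ is a dual order-isomorphism from $\mathrm{Con}_{\mathcal A}(\mathbf A)$ onto the lattice of all substructures of $D(\mathbf A)$ ordered by inclusion, with inverse $\mathbf Z\mapsto\theta_{\mathbf Z}=\{(a,b) : z(a)=z(b)\text{ for all }z\in Z\}$. It restricts to a dual order-isomorphism from the lattice $\mathrm{Con}_{\mathcal Q}(\mathbf A)\subseteq\mathrm{Con}_{\mathcal A}(\mathbf A)$ onto the set of $D(\mathbf B)$-substructures of $D(\mathbf A)$. Moreover, the $D(\mathbf B)$-substructures of $D(\mathbf A)$ form a lattice under inclusion, which is a join-subsemilattice of the lattice of all substructures of $D(\mathbf A)$. -/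

import Mathlib

open FirstOrder FirstOrder.Language

universe u v w x y z

namespace NatDual

/-! ### Algebras

An algebraic language is a `FirstOrder.Language` without relation symbols, an algebra is a nonempty
structure for it, homomorphisms are `A →[L] B`, and subalgebras (possibly empty) are
`L.Substructure A`. -/

section Algebra

variable (L : FirstOrder.Language.{v, w})

/-- The power `B ^ I` with the pointwise structure. -/
instance powStructure (I : Type x) (B : Type y) [L.Structure B] : L.Structure (I → B) where
  funMap f a := fun i => Structure.funMap f fun j => a j i
  RelMap r a := ∀ i, Structure.RelMap r fun j => a j i

/-- `C ∈ ISP(B)`: the algebra `C` is isomorphic to a subalgebra of a power of `B`, that is, it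
embeds into a power of `B`. The index set may be empty, so one-element algebras belong
to `ISP(B)`. -/
def InISP (B : Type u) [L.Structure B] (C : Type u) [L.Structure C] : Prop :=
  ∃ I : Type u, Nonempty (C ↪[L] (I → B))

/-- Congruences of the algebra `A`: equivalence relations compatible with all operations. -/
@[ext]
structure Congruence (A : Type u) [L.Structure A] extends Setoid A where
  funMap_rel : ∀ {n : ℕ} (f : L.Functions n) (a b : Fin n → A),
    (∀ i, toSetoid (a i) (b i)) → toSetoid (Structure.funMap f a) (Structure.funMap f b)

namespace Congruence

variable {L} {A : Type u} [L.Structure A]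

theorem toSetoid_injective :
    Function.Injective (Congruence.toSetoid : Congruence L A → Setoid A) := by
  rintro ⟨s, hs⟩ ⟨t, ht⟩ h
  cases h
  rfl

/-- Congruences are ordered by inclusion. -/
instance : PartialOrder (Congruence L A) :=
  PartialOrder.lift Congruence.toSetoid toSetoid_injective

variable [L.IsAlgebraic]

instance (θ : Congruence L A) : L.Prestructure θ.toSetoid where
  toStructure := inferInstance
  fun_equiv {_ f} a b h := θ.funMap_rel f a b h
  rel_equiv {_ r} _ _ _ := isEmptyElim r

/-- The quotient algebra `A / θ`. -/
abbrev Quot (θ : Congruence L A) : Type u := Quotient θ.toSetoid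

/-- The natural projection `A → A / θ`. -/
def proj (θ : Congruence L A) : A →[L] θ.Quot where
  toFun a := Quotient.mk θ.toSetoid a
  map_fun' f a := (funMap_quotient_mk' θ.toSetoid f a).symm
  map_rel' r _ := isEmptyElim r

end Congruence

/-- The `ISP(B)`-congruences of `A`, ordered by inclusion. -/
abbrev ConISP [L.IsAlgebraic] (B : Type u) [L.Structure B] (A : Type u) [L.Structure A] : Type u :=
  {θ : Congruence L A // InISP L B θ.Quot}

end Algebra

/-! ### Structured topological spaces -/

/-- A type of structured spaces: symbols for (total) operations of arity `n`, and symbols for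
partial operations and relations of arity `n + 1`. -/
structure Signature where
  Op : ℕ → Type x
  POp : ℕ → Type y
  Rel : ℕ → Type z

/-- Topological structures of type `σ`. The underlying set may be empty (if there
are no nullary operation symbols). -/
structure StrSpace (σ : Signature.{x, y, z}) where
  carrier : Type u
  top : TopologicalSpace carrier
  op : ∀ {n : ℕ}, σ.Op n → (Fin n → carrier) → carrier
  pop : ∀ {n : ℕ}, σ.POp n → (Fin (n + 1) → carrier) →. carrier
  rel : ∀ {n : ℕ}, σ.Rel n → Set (Fin (n + 1) → carrier)

namespace StrSpace

variable {σ : Signature.{x, y, z}}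

instance : CoeSort (StrSpace.{u} σ) (Type u) := ⟨StrSpace.carrier⟩

instance (X : StrSpace.{u} σ) : TopologicalSpace X := X.top

/-- The power `X ^ S` with the product topology and the pointwise structure; a partial operation
is defined at a tuple iff it is defined at each coordinate. -/
def power (X : StrSpace.{u} σ) (S : Type u) : StrSpace.{u} σ where
  carrier := S → X
  top := Pi.topologicalSpace
  op g a := fun s => X.op g fun i => a i s
  pop h a := ⟨∀ s, (X.pop h fun i => a i s).Dom, fun hd s => (X.pop h fun i => a i s).get (hd s)⟩
  rel r := {a | ∀ s, (fun i => a i s) ∈ X.rel r}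

/-- Morphisms: continuous structure-preserving maps. Where `h` is defined at `a`, it is
defined at the image of `a`, with the image value. -/
@[ext]
structure Mor (X Y : StrSpace.{u} σ) where
  toFun : X → Y
  continuous_toFun : Continuous toFun
  map_op : ∀ {n : ℕ} (g : σ.Op n) (a : Fin n → X), toFun (X.op g a) = Y.op g (toFun ∘ a)
  map_pop : ∀ {n : ℕ} (h : σ.POp n) (a : Fin (n + 1) → X) (b : X),
    b ∈ X.pop h a → toFun b ∈ Y.pop h (toFun ∘ a)
  map_rel : ∀ {n : ℕ} (r : σ.Rel n) (a : Fin (n + 1) → X), a ∈ X.rel r → toFun ∘ a ∈ Y.rel r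

instance (X Y : StrSpace.{u} σ) : FunLike (Mor X Y) X Y where
  coe := Mor.toFun
  coe_injective := fun _ _ h => Mor.ext h

/-- Embeddings: the image is a substructure of the codomain (closed under the partial operations
where they are defined) and the map is an isomorphism onto that substructure. -/
structure Mor.IsEmbedding {X Y : StrSpace.{u} σ} (φ : Mor X Y) : Prop where
  isEmbedding : Topology.IsEmbedding φ
  reflect_pop : ∀ {n : ℕ} (h : σ.POp n) (a : Fin (n + 1) → X) (c : Y),
    c ∈ Y.pop h (φ ∘ a) → ∃ b, b ∈ X.pop h a ∧ φ b = c
  reflect_rel : ∀ {n : ℕ} (r : σ.Rel n) (a : Fin (n + 1) → X), φ ∘ a ∈ Y.rel r → a ∈ X.rel r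

/-- Substructures of `X` (possibly empty, if there are no nullary operation symbols): subsets
closed under the operations, and under the partial operations where these are defined. -/
@[ext]
structure Substr (X : StrSpace.{u} σ) where
  carrier : Set X
  op_mem : ∀ {n : ℕ} (g : σ.Op n) (a : Fin n → X), (∀ i, a i ∈ carrier) → X.op g a ∈ carrier
  pop_mem : ∀ {n : ℕ} (h : σ.POp n) (a : Fin (n + 1) → X) (b : X),
    (∀ i, a i ∈ carrier) → b ∈ X.pop h a → b ∈ carrier

namespace Substr

variable {X : StrSpace.{u} σ}

instance : SetLike (Substr X) X where
  coe := Substr.carrier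
  coe_injective := fun _ _ h => Substr.ext h

/-- Substructures are ordered by inclusion. -/
instance : PartialOrder (Substr X) := .ofSetLike (Substr X) X

instance : InfSet (Substr X) where
  sInf U :=
    { carrier := {p | ∀ Z ∈ U, p ∈ Z}
      op_mem := fun g a ha Z hZ => Substr.op_mem Z g a fun i => ha i Z hZ
      pop_mem := fun h a b ha hb Z hZ => Substr.pop_mem Z h a b (fun i => ha i Z hZ) hb }

/-- The complete lattice of all substructures of `X`. -/
instance : CompleteLattice (Substr X) :=
  completeLatticeOfInf (Substr X) fun _ =>
    ⟨fun Z hZ _ hp => hp Z hZ, fun _ hW _ hp Z hZ => hW hZ hp⟩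

/-- The substructure `⟨T⟩` generated by a subset. -/
def gen (T : Set X) : Substr X := sInf {Z | T ⊆ Z}

/-- `Z` is a `Y`-substructure of `X`: it is generated by the union of the images of finitely many
(possibly no) morphisms from `Y` to `X`. -/
def IsFrom (Y : StrSpace.{u} σ) (Z : Substr X) : Prop :=
  ∃ (m : ℕ) (φ : Fin m → Mor Y X), Z = gen (⋃ i, Set.range (φ i))

end Substr

end StrSpace

open StrSpace

/-! ### Alter egos and natural dualities -/

/-- An alter ego of type `σ` for the algebra `M`: operations are homomorphisms `M ^ n → M`, partial
operations are homomorphisms from subalgebras of powers of `M` to `M`, and relations are subalgebras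
of powers of `M`. -/
structure AlterEgo (L : FirstOrder.Language.{v, w}) (M : Type u) [L.Structure M]
    (σ : Signature.{x, y, z}) where
  op : ∀ {n : ℕ}, σ.Op n → ((Fin n → M) →[L] M)
  dom : ∀ {n : ℕ}, σ.POp n → L.Substructure (Fin (n + 1) → M)
  pop : ∀ {n : ℕ} (h : σ.POp n), dom h →[L] M
  rel : ∀ {n : ℕ}, σ.Rel n → L.Substructure (Fin (n + 1) → M)

namespace AlterEgo

variable {L : FirstOrder.Language.{v, w}} {M : Type u} [L.Structure M] {σ : Signature.{x, y, z}}

/-- The alter ego as a discretely topologized structure. -/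
def space (T : AlterEgo L M σ) : StrSpace.{u} σ where
  carrier := M
  top := ⊥
  op g a := T.op g a
  pop h a := ⟨a ∈ T.dom h, fun ha => T.pop h ⟨a, ha⟩⟩
  rel r := {a | a ∈ T.rel r}

/-- The class `IS_cP⁺(T)`: isomorphic copies of closed substructures of nonempty powers of `T`,
including the empty structure if there are no nullary operation symbols. -/
def InX (T : AlterEgo L M σ) (X : StrSpace.{u} σ) : Prop :=
  ∃ (S : Type u) (_ : Nonempty S) (φ : Mor X (T.space.power S)),
    φ.IsEmbedding ∧ IsClosed (Set.range φ)

variable [L.IsAlgebraic]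

/-- The dual space `D(A)` of `A`: the set of homomorphisms `A → M` with the structure and topology
inherited from the power `T ^ A`. -/
def D (T : AlterEgo L M σ) (A : Type u) [L.Structure A] : StrSpace.{u} σ where
  carrier := A →[L] M
  top := TopologicalSpace.induced (fun p : A →[L] M => (p : A → M)) (T.space.power A).top
  op g p :=
    { toFun := fun a => T.op g fun i => p i a
      map_fun' := fun f a =>
        (congrArg (T.op g) (funext fun i => HomClass.map_fun (p i) f a)).trans
          (HomClass.map_fun (T.op g) f fun j i => p i (a j))
      map_rel' := fun r _ => isEmptyElim r }
  pop h p :=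
    ⟨∀ a, (fun i => p i a) ∈ T.dom h, fun hd =>
      { toFun := fun a => T.pop h ⟨fun i => p i a, hd a⟩
        map_fun' := fun f a =>
          (congrArg (T.pop h) (Subtype.ext (funext fun i => HomClass.map_fun (p i) f a))).trans
            (HomClass.map_fun (T.pop h) f fun j => ⟨fun i => p i (a j), hd (a j)⟩)
        map_rel' := fun r _ => isEmptyElim r }⟩
  rel r := {p | ∀ a, (fun i => p i a) ∈ T.rel r}

/-- `D` on morphisms: precomposition with `f : A → C`. -/
def mapD (T : AlterEgo L M σ) {A C : Type u} [L.Structure A] [L.Structure C] (f : A →[L] C) :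
    Mor (T.D C) (T.D A) where
  toFun p := Hom.comp (show C →[L] M from p) f
  continuous_toFun := by
    let _ : TopologicalSpace M := ⊥
    have h : Continuous fun p : T.D C => (Hom.toFun p : C → M) := continuous_induced_dom
    refine continuous_induced_rng.2 (continuous_pi fun a => ?_)
    exact (continuous_apply (f a)).comp h
  map_op _ _ := rfl
  map_pop h a b := by
    rintro ⟨hd, rfl⟩
    exact ⟨fun c => hd (f c), rfl⟩
  map_rel r a ha c := ha (f c)

/-- The underlying set `X(X, T)` of `E(X)`. -/
abbrev E (T : AlterEgo L M σ) (X : StrSpace.{u} σ) : Type u := Mor X T.space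

/-- `E(X)` is an algebra under pointwise operations, as a subalgebra of the power `M ^ X`. -/
instance (T : AlterEgo L M σ) (X : StrSpace.{u} σ) : L.Structure (T.E X) where
  funMap {k} f φ :=
    { toFun := fun p => (Structure.funMap f fun i => (φ i p : M) : M)
      continuous_toFun := by
        let _ : TopologicalSpace M := ⊥
        have _ : DiscreteTopology M := ⟨rfl⟩
        have h : Continuous fun (p : X) (i : Fin k) => (φ i p : M) :=
          continuous_pi fun i => (φ i).continuous_toFun
        exact (continuous_of_discreteTopology (f := fun m : Fin k → M => Structure.funMap f m)).comp h
      map_op := fun g a =>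
        (congrArg (Structure.funMap (M := M) f) (funext fun i => (φ i).map_op g a)).trans
          (HomClass.map_fun (T.op g) f fun i j => φ i (a j)).symm
      map_pop := fun h a b hb => by
        have hd : ∀ i, (fun j => (φ i (a j) : M)) ∈ T.dom h :=
          fun i => ((φ i).map_pop h a b hb).1
        have hv : ∀ i, T.pop h ⟨fun j => (φ i (a j) : M), hd i⟩ = φ i b :=
          fun i => ((φ i).map_pop h a b hb).2
        refine ⟨(T.dom h).fun_mem f (fun i j => φ i (a j)) hd, ?_⟩
        exact (HomClass.map_fun (T.pop h) f fun i => ⟨fun j => φ i (a j), hd i⟩).trans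
          (congrArg (Structure.funMap (M := M) f) (a₂ := fun i => φ i b) (funext fun i => hv i))
      map_rel := fun r a ha =>
        (T.rel r).fun_mem f (fun i j => φ i (a j)) fun i => (φ i).map_rel r a ha }
  RelMap r _ := isEmptyElim r

/-- `T` yields a duality on `ISP(M)`: each evaluation map `C → ED(C)` is surjective. (It is an
embedding in any case.) -/
def YieldsDuality (T : AlterEgo L M σ) : Prop :=
  ∀ (C : Type u) [L.Structure C] [Nonempty C], InISP L M C →
    ∀ ψ : T.E (T.D C), ∃ c : C, ∀ p : C →[L] M, ψ p = p c

/-- The duality is full: also each evaluation map `X → DE(X)` is surjective. (It is an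
embedding in any case.) -/
def YieldsFullDuality (T : AlterEgo L M σ) : Prop :=
  T.YieldsDuality ∧
    ∀ X : StrSpace.{u} σ, T.InX X →
      ∀ q : T.E X →[L] M, ∃ p : X, ∀ ψ : T.E X, q ψ = ψ p

/-- `T` is injective in the category of structured spaces that it generates. -/
def IsInjective (T : AlterEgo L M σ) : Prop :=
  ∀ X Y : StrSpace.{u} σ, T.InX X → T.InX Y → ∀ φ : Mor X Y, φ.IsEmbedding →
    ∀ α : Mor X T.space, ∃ β : Mor Y T.space, ∀ p : X, β (φ p) = α p

/-- `T` yields a strong duality: the duality is full (so that `ISP(M)` and the category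
of structured spaces are dually equivalent) and `T` is injective in that category. -/
def YieldsStrongDuality (T : AlterEgo L M σ) : Prop :=
  T.YieldsFullDuality ∧ T.IsInjective

/-- The `D(B)`-substructures of `D(A)`, ordered by inclusion. -/
abbrev DSub (T : AlterEgo L M σ) (B A : Type u) [L.Structure B] [L.Structure A] : Type u :=
  {Z : Substr (T.D A) // Z.IsFrom (T.D B)}

end AlterEgo

/-- The partial order `P` is a lattice: any two elements have a supremum and an infimum. -/
def IsLatticeOrder (P : Type u) [PartialOrder P] : Prop :=
  ∀ a b : P, (∃ c, IsLUB {a, b} c) ∧ ∃ c, IsGLB {a, b} c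

end NatDual

/-!
Membership of `C` in `ISP(B)` means that the homomorphisms `C → B` separate the points of `C`
(`inISP_iff`), so an `ISP(M)`-congruence `θ` of `A` is the common kernel of the homomorphisms
`A → M` that respect it, and these homomorphisms form the image of `D(A → A / θ)`
(`range_mapD_proj`). This gives an antitone Galois connection between congruences and substructures
of `D(A)`, given by `annihilator` and `commonKernel`. Only one point needs the strong duality: every
substructure `Z` of `D(A)` is Galois-closed (`annihilator_commonKernel`). Let `p : A → M` respect the
common kernel of `Z`. By injectivity of the alter ego and duality for `A`, every morphism from `Z`
to the alter ego is evaluation at some `a : A`. Sending it to `p a` is a well-defined homomorphism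
`E(Z) → M`, which by fullness is evaluation at some `z ∈ Z`; so `p = z`.

For the restriction to `ISP(B)`, duality for `B` shows that every morphism `D(B) → D(A)` has the
form `D(f)` with `f : A → B` (`exists_eq_mapD`). Since the homomorphisms `B → M` separate
points, the common kernel of the image of `D(f)` is the kernel of `f`. Hence the substructures
generated by images of finitely many morphisms `D(B) → D(A)` correspond to the finite intersections
of kernels of homomorphisms `A → B`. As `A` and `B` are finite, these are exactly the
`ISP(B)`-congruences (`isFrom_annihilator_iff`).

The `D(B)`-substructures contain the least substructure and are closed under binary joins; as `D(A)`
is finite, the join of all common lower bounds of two of them is again one, and it is their meet.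
-/

namespace NatDual

/-! ### Separation by homomorphisms and common kernels -/

section Separation

variable {L : FirstOrder.Language.{v, w}} [L.IsAlgebraic]

/-- `C ∈ ISP(B)` iff the homomorphisms `C → B` separate the points of `C`: they then embed `C` into
the power of `B` indexed by all of them. -/
theorem inISP_iff {B C : Type u} [L.Structure B] [L.Structure C] :
    InISP L B C ↔ ∀ c d : C, (∀ p : C →[L] B, p c = p d) → c = d := by
  constructor
  · rintro ⟨I, ⟨e⟩⟩ c d h
    apply e.injective
    funext i
    let p : C →[L] B :=
      { toFun := fun x => e x i
        map_fun' := fun f x => congrFun (HomClass.map_fun e f x) i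
        map_rel' := fun r _ => isEmptyElim r }
    exact h p
  · intro h
    exact ⟨C →[L] B, ⟨{
      toFun := fun c p => p c
      inj' := fun c d hcd => h c d fun p => congrFun hcd p
      map_fun' := fun f x => funext fun p => HomClass.map_fun p f x
      map_rel' := fun r _ => isEmptyElim r }⟩⟩

theorem InISP.trans {B C K : Type u} [L.Structure B] [L.Structure C] [L.Structure K]
    (hB : InISP L K B) (hC : InISP L B C) : InISP L K C := by
  rw [inISP_iff] at hB hC ⊢
  exact fun c d h => hC c d fun g => hB _ _ fun p => h (p.comp g)

variable {A B : Type u} [L.Structure A] [L.Structure B]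

/-- The homomorphism `A / θ → B` induced by a homomorphism `A → B` that respects `θ`. -/
def Congruence.lift (θ : Congruence L A) (p : A →[L] B)
    (h : ∀ a b, θ.toSetoid a b → p a = p b) : θ.Quot →[L] B where
  toFun := Quotient.lift p h
  map_fun' {n} f x := by
    obtain ⟨a, rfl⟩ : ∃ a : Fin n → A, (fun i => θ.proj (a i)) = x :=
      ⟨fun i => (x i).out, funext fun i => Quotient.out_eq (x i)⟩
    exact (congrArg (Quotient.lift p h) (HomClass.map_fun θ.proj f a).symm).trans
      (HomClass.map_fun p f a)
  map_rel' r _ := isEmptyElim r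

theorem Congruence.proj_eq_iff (θ : Congruence L A) {a b : A} :
    θ.proj a = θ.proj b ↔ θ.toSetoid a b :=
  Quotient.eq

/-- `A / θ ∈ ISP(B)` iff `θ` is an intersection of kernels of homomorphisms `A → B`. -/
theorem inISP_quot_iff (θ : Congruence L A) :
    InISP L B θ.Quot ↔ ∀ a b, (∀ p : A →[L] B,
      (∀ c d, θ.toSetoid c d → p c = p d) → p a = p b) → θ.toSetoid a b := by
  rw [inISP_iff]
  constructor
  · intro h a b hab
    refine θ.proj_eq_iff.1 (h _ _ fun q => hab (q.comp θ.proj) fun c d hcd => ?_)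
    exact congrArg q (θ.proj_eq_iff.2 hcd)
  · intro h x y
    induction x using Quotient.inductionOn with | _ a => ?_
    induction y using Quotient.inductionOn with | _ b => ?_
    exact fun hxy => θ.proj_eq_iff.2 (h a b fun p hp => hxy (θ.lift p hp))

/-- The congruence `{(a, b) | p a = p b for all p ∈ S}` of `A`. -/
def commonKernel (S : Set (A →[L] B)) : Congruence L A where
  r a b := ∀ p ∈ S, p a = p b
  iseqv := ⟨fun _ _ _ => rfl, fun h p hp => (h p hp).symm,
    fun h k p hp => (h p hp).trans (k p hp)⟩
  funMap_rel f a b h p hp :=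
    ((HomClass.map_fun p f a).trans (congrArg _ (funext fun i => h i p hp))).trans
      (HomClass.map_fun p f b).symm

theorem inISP_commonKernel (S : Set (A →[L] B)) : InISP L B (commonKernel S).Quot :=
  (inISP_quot_iff _).2 fun _ _ h p hp => h p fun _ _ hcd => hcd p hp

end Separation

/-! ### Substructures as structured spaces -/

namespace StrSpace

variable {σ : Signature.{x, y, z}} {X : StrSpace.{u} σ}

/-- A substructure as a structured space, with the subspace topology; a partial operation is
defined at a tuple of the substructure iff it is defined in the ambient space. -/
def Substr.space (Z : Substr X) : StrSpace.{u} σ where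
  carrier := Z
  top := inferInstance
  op g a := ⟨X.op g fun i => a i, Z.op_mem g _ fun i => (a i).2⟩
  pop h a := ⟨(X.pop h fun i => a i).Dom, fun hd =>
    ⟨(X.pop h fun i => a i).get hd, Z.pop_mem h _ _ (fun i => (a i).2) (Part.get_mem hd)⟩⟩
  rel r := {a | (fun i => (a i : X)) ∈ X.rel r}

/-- The inclusion of a substructure. -/
def Substr.incl (Z : Substr X) : Mor Z.space X where
  toFun := fun p : Z => p.1
  continuous_toFun := continuous_subtype_val (p := fun p : X => p ∈ Z)
  map_op _ _ := rfl
  map_pop h a b := by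
    rintro ⟨hd, rfl⟩
    exact ⟨hd, rfl⟩
  map_rel _ _ ha := ha

theorem Substr.isEmbedding_incl (Z : Substr X) : Z.incl.IsEmbedding where
  isEmbedding := Topology.IsEmbedding.subtypeVal (p := fun p : X => p ∈ Z)
  reflect_pop h a c := by
    rintro ⟨hd, rfl⟩
    exact ⟨⟨_, Z.pop_mem h _ _ (fun i => (a i).2) (Part.get_mem hd)⟩, ⟨hd, rfl⟩, rfl⟩
  reflect_rel _ _ ha := ha

/-- Composition of morphisms. -/
def Mor.comp {X Y W : StrSpace.{u} σ} (ψ : Mor Y W) (φ : Mor X Y) : Mor X W where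
  toFun p := ψ (φ p)
  continuous_toFun := ψ.continuous_toFun.comp φ.continuous_toFun
  map_op g a := (congrArg ψ (φ.map_op g a)).trans (ψ.map_op g _)
  map_pop h a b hb := ψ.map_pop h _ _ (φ.map_pop h a b hb)
  map_rel r a ha := ψ.map_rel r _ (φ.map_rel r a ha)

theorem Mor.IsEmbedding.comp {X Y W : StrSpace.{u} σ} {ψ : Mor Y W} {φ : Mor X Y}
    (hψ : ψ.IsEmbedding) (hφ : φ.IsEmbedding) : (ψ.comp φ).IsEmbedding where
  isEmbedding := hψ.isEmbedding.comp hφ.isEmbedding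
  reflect_pop h a c hc := by
    obtain ⟨b, hb, rfl⟩ := hψ.reflect_pop h (φ ∘ a) c hc
    obtain ⟨d, hd, rfl⟩ := hφ.reflect_pop h a b hb
    exact ⟨d, hd, rfl⟩
  reflect_rel r a ha := hφ.reflect_rel r a (hψ.reflect_rel r (φ ∘ a) ha)

theorem Substr.subset_gen (S : Set X) : S ⊆ gen S := fun _ hp _ hZ => hZ hp

theorem Substr.gen_le {S : Set X} {Z : Substr X} (h : S ⊆ Z) : gen S ≤ Z :=
  sInf_le (a := Z) h

theorem Substr.gen_union (S S' : Set X) : gen (S ∪ S') = gen S ⊔ gen S' := by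
  apply le_antisymm
  · have h₁ : gen S ≤ gen S ⊔ gen S' := le_sup_left
    have h₂ : gen S' ≤ gen S ⊔ gen S' := le_sup_right
    exact gen_le (Set.union_subset (fun p hp => h₁ (subset_gen S hp))
      fun p hp => h₂ (subset_gen S' hp))
  · exact sup_le (gen_le fun p hp => subset_gen _ (Or.inl hp))
      (gen_le fun p hp => subset_gen _ (Or.inr hp))

theorem Substr.isFrom_bot (Y : StrSpace.{u} σ) : IsFrom Y (⊥ : Substr X) :=
  ⟨0, Fin.elim0, (le_bot_iff.1 (gen_le (by simp))).symm⟩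

theorem Substr.supClosed_isFrom (Y : StrSpace.{u} σ) :
    SupClosed {Z : Substr X | Z.IsFrom Y} := by
  rintro _ ⟨m, φ, rfl⟩ _ ⟨n, ψ, rfl⟩
  refine ⟨m + n, Fin.append φ ψ, ?_⟩
  rw [← gen_union]
  congr 1
  ext p
  simp only [Set.mem_union, Set.mem_iUnion]
  constructor
  · rintro (⟨i, hi⟩ | ⟨i, hi⟩)
    · exact ⟨Fin.castAdd n i, by rwa [Fin.append_left]⟩
    · exact ⟨Fin.natAdd m i, by rwa [Fin.append_right]⟩
  · rintro ⟨i, hi⟩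
    induction i using Fin.addCases with
    | left i => exact Or.inl ⟨i, by rwa [Fin.append_left] at hi⟩
    | right i => exact Or.inr ⟨i, by rwa [Fin.append_right] at hi⟩

/-- Infima exist because, in a finite space, the join of all common lower bounds is a finite join. -/
theorem Substr.isLatticeOrder_isFrom [Finite X] (Y : StrSpace.{u} σ) :
    IsLatticeOrder {Z : Substr X // Z.IsFrom Y} := by
  intro a b
  refine ⟨⟨⟨a.1 ⊔ b.1, supClosed_isFrom Y a.2 b.2⟩, ?_, ?_⟩, ?_⟩
  · rintro c (rfl | rfl)
    · exact le_sup_left (α := Substr X)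
    · exact le_sup_right (α := Substr X)
  · exact fun c hc => sup_le (α := Substr X) (hc (Or.inl rfl)) (hc (Or.inr rfl))
  · have : Finite (Substr X) := Finite.of_injective _ (SetLike.coe_injective (A := Substr X))
    let U : Set (Substr X) := {Z | Z.IsFrom Y ∧ Z ≤ a.1 ∧ Z ≤ b.1}
    let t : Finset (Substr X) := (Set.toFinite U).toFinset
    have ht : ∀ Z, Z ∈ t ↔ Z ∈ U := fun Z => Set.Finite.mem_toFinset _
    refine ⟨⟨t.sup id, Finset.sup_mem {Z : Substr X | Z.IsFrom Y} (isFrom_bot Y)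
      (fun _ h₁ _ h₂ => supClosed_isFrom Y h₁ h₂) t id fun Z hZ => ((ht Z).1 hZ).1⟩, ?_, ?_⟩
    · rintro c (rfl | rfl)
      · exact Finset.sup_le (α := Substr X) fun Z hZ => ((ht Z).1 hZ).2.1
      · exact Finset.sup_le (α := Substr X) fun Z hZ => ((ht Z).1 hZ).2.2
    · exact fun c hc => Finset.le_sup (α := Substr X) (f := id)
        ((ht c.1).2 ⟨c.2, hc (Or.inl rfl), hc (Or.inr rfl)⟩)

end StrSpace

theorem IsLatticeOrder.of_orderIso_dual {P Q : Type u} [PartialOrder P] [PartialOrder Q]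
    (h : IsLatticeOrder Q) (e : P ≃o Qᵒᵈ) : IsLatticeOrder P := by
  intro a b
  have key : ∀ s : Set Qᵒᵈ, s = {e a, e b} → e.symm '' s = {a, b} := by
    rintro _ rfl
    simp [Set.image_pair]
  obtain ⟨⟨c, hc⟩, d, hd⟩ := h (OrderDual.ofDual (e a)) (OrderDual.ofDual (e b))
  refine ⟨⟨e.symm (OrderDual.toDual d), ?_⟩, ⟨e.symm (OrderDual.toDual c), ?_⟩⟩
  · rw [← key {e a, e b} rfl]
    exact e.symm.isLUB_image'.2 (show IsLUB {e a, e b} (OrderDual.toDual d) from hd)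
  · rw [← key {e a, e b} rfl]
    exact e.symm.isGLB_image'.2 (show IsGLB {e a, e b} (OrderDual.toDual c) from hc)

/-! ### The Galois connection between congruences and substructures of the dual space -/

namespace AlterEgo

open StrSpace

variable {L : FirstOrder.Language.{v, w}} [L.IsAlgebraic] {M : Type u} [L.Structure M]
  {σ : Signature.{x, y, z}} (T : AlterEgo L M σ)

section

variable {A : Type u} [L.Structure A]

/-- The substructure of `D(A)` of all homomorphisms `A → M` that respect `θ`. -/
def annihilator (θ : Congruence L A) : Substr (T.D A) where
  carrier := {p : A →[L] M | ∀ a b, θ.toSetoid a b → p a = p b}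
  op_mem g _ hp a b hab := congrArg (T.op g) (funext fun i => hp i a b hab)
  pop_mem h _ _ hp hq a b hab := by
    obtain ⟨hd, rfl⟩ := hq
    exact congrArg (T.pop h) (Subtype.ext (funext fun i => hp i a b hab))

theorem range_mapD_proj (θ : Congruence L A) :
    Set.range (T.mapD θ.proj) = (T.annihilator θ : Set (T.D A)) := by
  ext p
  constructor
  · rintro ⟨q, rfl⟩ a b hab
    exact congrArg (show θ.Quot →[L] M from q) (θ.proj_eq_iff.2 hab)
  · intro hp
    exact ⟨θ.lift (show A →[L] M from p) hp, rfl⟩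

theorem subset_annihilator_iff {S : Set (A →[L] M)} {θ : Congruence L A} :
    S ⊆ (T.annihilator θ : Set (T.D A)) ↔ θ ≤ commonKernel S :=
  ⟨fun h _ _ hab _ hp => h hp _ _ hab, fun h _ hp _ _ hab => h hab _ hp⟩

theorem commonKernel_annihilator {θ : Congruence L A} (hθ : InISP L M θ.Quot) :
    commonKernel (T.annihilator θ : Set (T.D A)) = θ :=
  le_antisymm (fun a b h => (inISP_quot_iff θ).1 hθ a b h)
    ((T.subset_annihilator_iff).1 subset_rfl)

theorem commonKernel_gen (S : Set (A →[L] M)) :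
    commonKernel (Substr.gen (X := T.D A) S : Set (T.D A)) = commonKernel S := by
  apply le_antisymm
  · exact fun a b h p hp => h p (Substr.subset_gen (X := T.D A) S hp)
  · exact (T.subset_annihilator_iff).1
      (Substr.gen_le (X := T.D A) ((T.subset_annihilator_iff).2 le_rfl))

/-! ### Substructures of the dual space of a finite algebra are Galois-closed -/

/-- Evaluation at `a`, as a morphism from `D(A)` to the alter ego. -/
def eval (a : A) : Mor (T.D A) T.space where
  toFun := fun p : A →[L] M => p a
  continuous_toFun := (continuous_apply (A := fun _ => T.space) a).comp continuous_induced_dom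
  map_op _ _ := rfl
  map_pop h _ _ := by
    rintro ⟨hd, rfl⟩
    exact ⟨hd a, rfl⟩
  map_rel _ _ hp := hp a

/-- The inclusion of `D(A)` into the power of the alter ego indexed by `A`. -/
def inclD (A : Type u) [L.Structure A] : Mor (T.D A) (T.space.power A) where
  toFun := fun p : A →[L] M => (p : A → M)
  continuous_toFun := continuous_induced_dom
  map_op _ _ := rfl
  map_pop h p q := by
    rintro ⟨hd, rfl⟩
    exact ⟨hd, rfl⟩
  map_rel _ _ hp := hp

theorem isEmbedding_inclD : (T.inclD A).IsEmbedding where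
  isEmbedding := ⟨⟨rfl⟩, fun _ _ h => DFunLike.coe_injective (F := A →[L] M) h⟩
  reflect_pop h p c := by
    rintro ⟨hd, rfl⟩
    exact ⟨((T.D A).pop h p).get hd, ⟨hd, rfl⟩, rfl⟩
  reflect_rel _ _ hp := hp

/-- A power with finite exponent is discrete, so closedness of the image is automatic. -/
theorem inX_of_isEmbedding {L : FirstOrder.Language.{v, w}} {M : Type u} [L.Structure M]
    (T : AlterEgo L M σ) {A : Type u} [Finite A] [Nonempty A] {X : StrSpace.{u} σ}
    (φ : Mor X (T.space.power A)) (hφ : φ.IsEmbedding) : T.InX X := by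
  refine ⟨A, inferInstance, φ, hφ, ?_⟩
  have : DiscreteTopology T.space := ⟨rfl⟩
  have : DiscreteTopology (T.space.power A) :=
    inferInstanceAs (DiscreteTopology (A → T.space))
  exact isClosed_discrete _

variable {T}

theorem annihilator_commonKernel [Finite A] [Nonempty A] (hT : T.YieldsStrongDuality)
    (hA : InISP L M A) (Z : Substr (T.D A)) :
    T.annihilator (commonKernel (Z : Set (T.D A))) = Z := by
  refine le_antisymm ?_ ((T.subset_annihilator_iff).2 le_rfl)
  intro p hp
  have hX : T.InX (T.D A) := T.inX_of_isEmbedding _ T.isEmbedding_inclD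
  have hZ : T.InX Z.space :=
    T.inX_of_isEmbedding _ (T.isEmbedding_inclD.comp Z.isEmbedding_incl)
  have hev : ∀ ψ : T.E Z.space, ∃ a : A, ∀ q : Z, ψ q = T.eval a q.1 := by
    intro ψ
    obtain ⟨β, hβ⟩ := hT.2 _ _ hZ hX Z.incl Z.isEmbedding_incl ψ
    obtain ⟨a, ha⟩ := hT.1.1 A hA β
    exact ⟨a, fun q => (hβ q).symm.trans (ha q.1)⟩
  choose rep hrep using hev
  -- `p` does not depend on the choice of the point `rep ψ` that represents `ψ`.
  have hp' : ∀ (ψ : T.E Z.space) (a : A), (∀ q : Z, ψ q = T.eval a q.1) →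
      T.eval (rep ψ) p = T.eval a p :=
    fun ψ a ha => hp _ _ fun q hq => (hrep ψ ⟨q, hq⟩).symm.trans (ha ⟨q, hq⟩)
  let Q : T.E Z.space →[L] M :=
    { toFun := fun ψ => T.eval (rep ψ) p
      map_fun' := fun f ψ => by
        refine (hp' _ (Structure.funMap f fun i => rep (ψ i)) fun q => ?_).trans
          (HomClass.map_fun (show A →[L] M from p) f _)
        exact (congrArg (Structure.funMap (M := M) f) (funext fun i => hrep (ψ i) q)).trans
          (HomClass.map_fun (show A →[L] M from q.1) f _).symm
      map_rel' := fun r _ => isEmptyElim r }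
  obtain ⟨q, hq⟩ := hT.1.2 Z.space hZ Q
  have hpq : p = Z.incl q := by
    refine DFunLike.ext (F := A →[L] M) _ _ fun a => ?_
    exact (hp' ((T.eval a).comp Z.incl) a fun _ => rfl).symm.trans
      (hq ((T.eval a).comp Z.incl))
  exact hpq ▸ q.2

end

/-! ### Substructures generated by morphisms between dual spaces -/

section

variable {T} {A B : Type u} [L.Structure A] [L.Structure B]

theorem exists_eq_mapD [Nonempty B] (hT : T.YieldsDuality) (hB : InISP L M B)
    (φ : Mor (T.D B) (T.D A)) : ∃ f : A →[L] B, φ = T.mapD f := by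
  choose F hF using fun a : A => hT B hB ((T.eval a).comp φ)
  let f : A →[L] B :=
    { toFun := F
      map_fun' := fun g a => inISP_iff.1 hB _ _ fun p => by
        refine ((hF _ p).symm.trans
          (HomClass.map_fun (show A →[L] M from φ p) g a)).trans ?_
        refine Eq.trans ?_ (HomClass.map_fun p g (F ∘ a)).symm
        exact congrArg _ (funext fun i => hF (a i) p)
      map_rel' := fun r _ => isEmptyElim r }
  exact ⟨f, Mor.ext (funext fun p => DFunLike.ext (F := A →[L] M) _ _ fun a => hF a p)⟩

/-- As the homomorphisms `B → M` separate points, the image of `D(f)` has the common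
kernel `ker f`. -/
theorem commonKernel_gen_iUnion_range_mapD (hB : InISP L M B) {ι : Type*} (f : ι → A →[L] B) :
    commonKernel (Substr.gen (⋃ i, Set.range (T.mapD (f i))) : Set (T.D A)) =
      commonKernel (Set.range f) := by
  refine (T.commonKernel_gen (⋃ i, Set.range (T.mapD (f i)) : Set (T.D A))).trans ?_
  apply le_antisymm
  · rintro a b h _ ⟨i, rfl⟩
    exact inISP_iff.1 hB _ _ fun p => h _ (Set.mem_iUnion.2 ⟨i, p, rfl⟩)
  · intro a b h q hq
    obtain ⟨i, p, rfl⟩ := Set.mem_iUnion.1 hq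
    exact congrArg (show B →[L] M from p) (h _ ⟨i, rfl⟩)

theorem isFrom_annihilator_iff [Finite A] [Nonempty A] [Finite B] [Nonempty B]
    (hT : T.YieldsStrongDuality) (hA : InISP L M A) (hB : InISP L M B)
    {θ : Congruence L A} (hθ : InISP L M θ.Quot) :
    (T.annihilator θ).IsFrom (T.D B) ↔ InISP L B θ.Quot := by
  constructor
  · rintro ⟨m, φ, hφ⟩
    choose f hf using fun i => exists_eq_mapD hT.1.1 hB (φ i)
    obtain rfl : φ = fun i => T.mapD (f i) := funext hf
    have h := T.commonKernel_annihilator hθ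
    rw [hφ] at h
    exact (commonKernel_gen_iUnion_range_mapD hB f).symm.trans h ▸ inISP_commonKernel (Set.range f)
  · intro h
    -- All homomorphisms `A → B` that respect `θ`: finitely many, with common kernel `θ`.
    let S : Set (A →[L] B) := {f | ∀ a b, θ.toSetoid a b → f a = f b}
    have : Finite (A →[L] B) := Finite.of_injective _ DFunLike.coe_injective
    obtain ⟨m, f, hf⟩ : ∃ (m : ℕ) (f : Fin m → A →[L] B), Set.range f = S := by
      obtain ⟨m, ⟨e⟩⟩ := Finite.exists_equiv_fin S
      exact ⟨m, fun i => e.symm i, by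
        rw [← Function.comp_def, Set.range_comp, e.symm.range_eq_univ, Set.image_univ,
          Subtype.range_coe]⟩
    have hS : commonKernel S = θ :=
      le_antisymm (fun a b hab => (inISP_quot_iff θ).1 h a b hab)
        fun a b hab p hp => hp a b hab
    refine ⟨m, fun i => T.mapD (f i), ?_⟩
    refine Eq.trans ?_ (annihilator_commonKernel hT hA (Substr.gen _))
    exact congrArg T.annihilator
      ((commonKernel_gen_iUnion_range_mapD hB f).trans (hf ▸ hS)).symm

end

/-! ### The dual order-isomorphisms -/

section

variable {T} {A : Type u} [L.Structure A] [Finite A] [Nonempty A]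

/-- The dual order-isomorphism between `ISP(M)`-congruences of `A` and substructures of `D(A)`. -/
def conEquivSubstr (hT : T.YieldsStrongDuality) (hA : InISP L M A) :
    ConISP L M A ≃o (Substr (T.D A))ᵒᵈ where
  toFun θ := OrderDual.toDual (T.annihilator θ.1)
  invFun Z := ⟨commonKernel ((OrderDual.ofDual Z : Substr (T.D A)) : Set (T.D A)), inISP_commonKernel _⟩
  left_inv θ := Subtype.ext (T.commonKernel_annihilator θ.2)
  right_inv Z := annihilator_commonKernel hT hA (OrderDual.ofDual Z)
  map_rel_iff' {θ η} := by
    refine (T.subset_annihilator_iff (S := (T.annihilator η.1 : Set (T.D A)))).trans ?_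
    rw [T.commonKernel_annihilator η.2]
    rfl

/-- The restriction of `conEquivSubstr` to `ISP(B)`-congruences and `D(B)`-substructures. -/
def conEquivDSub {B : Type u} [L.Structure B] [Finite B] [Nonempty B]
    (hT : T.YieldsStrongDuality) (hA : InISP L M A) (hB : InISP L M B) :
    ConISP L B A ≃o (T.DSub B A)ᵒᵈ where
  toFun θ := OrderDual.toDual ⟨T.annihilator θ.1,
    (isFrom_annihilator_iff hT hA hB (hB.trans θ.2)).2 θ.2⟩
  invFun Z := ⟨commonKernel ((OrderDual.ofDual Z).1 : Set (T.D A)),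
    (isFrom_annihilator_iff hT hA hB (inISP_commonKernel _)).1
      ((annihilator_commonKernel hT hA _).symm ▸ (OrderDual.ofDual Z).2)⟩
  left_inv θ := Subtype.ext (T.commonKernel_annihilator (hB.trans θ.2))
  right_inv Z := Subtype.ext (annihilator_commonKernel hT hA (OrderDual.ofDual Z).1)
  map_rel_iff' {θ η} := (conEquivSubstr hT hA).map_rel_iff
    (a := ⟨θ.1, hB.trans θ.2⟩) (b := ⟨η.1, hB.trans η.2⟩)

end

end AlterEgo

end NatDual

theorem proposition5p3 {L : FirstOrder.Language.{v, w}} [L.IsAlgebraic]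
    {M : Type u} [L.Structure M] [Nonempty M] [Finite M]
    {σ : NatDual.Signature.{x, y, z}} (T : NatDual.AlterEgo L M σ) (hT : T.YieldsStrongDuality)
    (A : Type u) [L.Structure A] [Nonempty A] [Finite A] (hA : NatDual.InISP L M A)
    (B : Type u) [L.Structure B] [Nonempty B] [Finite B] (hB : NatDual.InISP L M B) :
    ∃ (Φ : NatDual.ConISP L M A ≃o (NatDual.StrSpace.Substr (T.D A))ᵒᵈ)
      (Ψ : NatDual.ConISP L B A ≃o (T.DSub B A)ᵒᵈ),
      -- `Φ` is the dual order-isomorphism given by `θ ↦ im D(A → A / θ)` with inverse `Z ↦ θ_Z`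
      (∀ θ : NatDual.ConISP L M A,
        ((OrderDual.ofDual (Φ θ) : NatDual.StrSpace.Substr (T.D A)) : Set (T.D A)) =
          Set.range (T.mapD θ.1.proj)) ∧
      (∀ (Z : NatDual.StrSpace.Substr (T.D A)) (a b : A),
        (Φ.symm (OrderDual.toDual Z)).1.toSetoid a b ↔ ∀ p : A →[L] M, p ∈ Z.carrier → p a = p b) ∧
      -- `Ψ` is the restriction of `Φ`
      (∀ θ : NatDual.ConISP L B A, ∃ hθ : NatDual.InISP L M θ.1.Quot,
        (OrderDual.ofDual (Ψ θ)).1 = OrderDual.ofDual (Φ ⟨θ.1, hθ⟩)) ∧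
      -- both sides are lattices, and joins of `D(B)`-substructures are joins of substructures
      NatDual.IsLatticeOrder (NatDual.ConISP L B A) ∧
      NatDual.IsLatticeOrder (T.DSub B A) ∧
      SupClosed {Z : NatDual.StrSpace.Substr (T.D A) | Z.IsFrom (T.D B)} := by
  have : Finite (T.D A) :=
    Finite.of_injective (β := A → M) (fun p => (show A →[L] M from p))
      (DFunLike.coe_injective (F := A →[L] M))
  have hlat : NatDual.IsLatticeOrder (T.DSub B A) :=
    NatDual.StrSpace.Substr.isLatticeOrder_isFrom (T.D B)
  exact ⟨NatDual.AlterEgo.conEquivSubstr hT hA, NatDual.AlterEgo.conEquivDSub hT hA hB,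
    fun θ => (T.range_mapD_proj θ.1).symm, fun _ _ _ => Iff.rfl,
    fun θ => ⟨hB.trans θ.2, rfl⟩, hlat.of_orderIso_dual (NatDual.AlterEgo.conEquivDSub hT hA hB),
    hlat, NatDual.StrSpace.Substr.supClosed_isFrom (T.D B)⟩
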